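/- Let $\nu_n$ ($n\ge 1$) and $\nu$ be Lévy measures on $(0,\infty)$ such that $\gamma_n=\int_{(0,1]}x\,\nu_n(dx)$ and $\gamma=\int_{(0,1]}x\,\nu(dx)$ are finite, and assume $\nu(\{1\})=0$ (this holds in particular if $\nu$ has a density with respect to Lebesgue measure). Let $X^{(n)}$ and $X$ be real-valued Lévy processes with Lévy triplets $(\gamma_n,0,\nu_n)$ and $(\gamma,0,\nu)$ respectively, where the triplets are taken with respect to the truncation function $x\mathbf 1_{\{|x|\le 1\}}$, i.e. the characteristic function of $X_1$ is $$\phi_{X_1}(z)=\exp\Big(\mathrm i\gamma z+\int_{(0,\infty)}\big(e^{\mathrm izx}-1-\mathrm izx\mathbf 1_{\{|x|\le 1\}}\big)\,\nu(dx)\Big),\qquad z\in\mathbb R,$$ and similarly for $X^{(n)}$ (so these processes are subordinators with zero drift). Let $\mathbb Q_n$ and $\mathbb Q$ be the laws of the increments $X^{(n)}_1-X^{(n)}_0$ and $X_1-X_0$, and define the finite Borel measures $$\widetilde\nu_n(dx)=\gamma_n\,\delta_0(dx)+(x^2\wedge 1)\,\nu_n(dx),\qquad \widetilde\nu(dx)=\gamma\,\delta_0(dx)+(x^2\wedge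 1)\,\nu(dx)$$ on $\mathbb R$, where $\delta_0$ is the Dirac measure at $0$. Then $\mathbb Q_n$ converges weakly to $\mathbb Q$ as $n\to\infty$ if and only if $\widetilde\nu_n$ converges weakly to $\widetilde\nu$ as $n\to\infty$. -/

import Mathlib

open MeasureTheory ProbabilityTheory Filter Topology
open scoped NNReal ENNReal

/-- `X = (X_t)_{t ≥ 0}` is a real-valued Lévy process under `P`: it starts at zero, has independent
and stationary increments, and its sample paths are càdlàg almost surely. -/
structure IsLevyProcess {Ω : Type*} [MeasurableSpace Ω] (X : ℝ≥0 → Ω → ℝ) (P : Measure Ω) :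
    Prop where
  measurable : ∀ t, Measurable (X t)
  zero : ∀ᵐ ω ∂P, X 0 ω = 0
  indep_increments : HasIndepIncrements X P
  stationary_increments : ∀ s h : ℝ≥0,
    IdentDistrib (fun ω => X (s + h) ω - X s ω) (fun ω => X h ω - X 0 ω) P P
  cadlag : ∀ᵐ ω ∂P, ∀ t : ℝ≥0,
    ContinuousWithinAt (fun s => X s ω) (Set.Ici t) t ∧
      ∃ l : ℝ, Tendsto (fun s => X s ω) (𝓝[<] t) (𝓝 l)

/-- `ν` is a Lévy measure on the real line: it does not charge `0`, and `∫ (x² ∧ 1) ν(dx) < ∞`. -/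
structure IsLevyMeasure (ν : Measure ℝ) : Prop where
  zero : ν {0} = 0
  lintegral_lt_top : ∫⁻ x, ENNReal.ofReal (min (x ^ 2) 1) ∂ν < ∞

/-- The Lévy-Khintchine exponent of the triplet `(γ, A, ν)` (with truncation at `|x| ≤ 1`), where
`γ` is the first component, `A` the Gaussian variance and `ν` the Lévy measure. -/
noncomputable def levyExponent (γ : ℝ) (A : ℝ≥0) (ν : Measure ℝ) (z : ℝ) : ℂ :=
  Complex.I * γ * z - A * z ^ 2 / 2 +
    ∫ x : ℝ, (Complex.exp (Complex.I * z * x) - 1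
      - Set.indicator {y : ℝ | |y| ≤ 1} (fun y : ℝ => Complex.I * z * y) x) ∂ν

/-- The Lévy process `X` has generating triplet `(γ, A, ν)`: the Lévy-Khintchine formula holds for
the characteristic function of `X_1`. -/
structure HasLevyTriplet {Ω : Type*} [MeasurableSpace Ω] (X : ℝ≥0 → Ω → ℝ) (P : Measure Ω)
    (γ : ℝ) (A : ℝ≥0) (ν : Measure ℝ) : Prop where
  isLevy : IsLevyProcess X P
  isLevyMeasure : IsLevyMeasure ν
  charFun_eq : ∀ z : ℝ, charFun (P.map (X 1)) z = Complex.exp (levyExponent γ A ν z)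

/-- The law of the unit-time increment `Z_1 = X_1 - X_0` of a Lévy process. -/
noncomputable def incrementLaw {Ω : Type*} [MeasurableSpace Ω] (X : ℝ≥0 → Ω → ℝ) (P : Measure Ω)
    [IsProbabilityMeasure P] (hX : IsLevyProcess X P) : ProbabilityMeasure ℝ :=
  ⟨P.map (fun ω => X 1 ω - X 0 ω),
    Measure.isProbabilityMeasure_map ((hX.measurable 1).sub (hX.measurable 0)).aemeasurable⟩

/-- The measure `γ δ₀(dx) + (x² ∧ 1) ν(dx)`. It is used for `γ ≥ 0` only. -/
noncomputable def tildeMeasure (γ : ℝ) (ν : Measure ℝ) : Measure ℝ :=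
  ENNReal.ofReal γ • Measure.dirac 0 + ν.withDensity (fun x => ENNReal.ofReal (min (x ^ 2) 1))

theorem IsLevyMeasure.isFiniteMeasure_tildeMeasure {ν : Measure ℝ} (hν : IsLevyMeasure ν) (γ : ℝ) :
    IsFiniteMeasure (tildeMeasure γ ν) := by
  have h1 : IsFiniteMeasure (ν.withDensity (fun x => ENNReal.ofReal (min (x ^ 2) 1))) :=
    isFiniteMeasure_withDensity hν.lintegral_lt_top.ne
  have h2 : IsFiniteMeasure (ENNReal.ofReal γ • Measure.dirac (0 : ℝ)) :=
    Measure.smul_finite _ ENNReal.ofReal_ne_top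
  unfold tildeMeasure
  infer_instance

/-- `γ δ₀(dx) + (x² ∧ 1) ν(dx)` as a finite Borel measure, for a Lévy measure `ν`; finite Borel
measures carry the topology of weak convergence. -/
noncomputable def tildeFiniteMeasure (γ : ℝ) (ν : Measure ℝ) (hν : IsLevyMeasure ν) :
    FiniteMeasure ℝ :=
  ⟨tildeMeasure γ ν, hν.isFiniteMeasure_tildeMeasure γ⟩

/-! Since γ is the integral of x over (0,1], the compensator cancels and the law is that of a
driftless subordinator: it lives on [0,∞), with Laplace transform exp(-Φ(k)), Φ(k) = ∫ (1 - e^{-kx})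
ν(dx). To see this without analytic continuation, ν is cut off near 0; the resulting compound
Poisson laws have explicit characteristic functions and Laplace transforms, and converge to the
given law (`laplace_of_charFun`).

By Weierstrass approximation in the variable e^{-x}, Laplace transforms at integers determine weak
convergence (`integralTendsto_of_laplace`). So the laws converge iff Φ_n(k) → Φ(k) for all k.
Because Φ(k+1) - Φ(k) is the Laplace transform of (1 - e^{-x}) ν(dx), the same theorem turns this
into weak convergence of these finite measures, equivalently of (x ∧ 1) ν_n
(`laplaceExponent_tendsto_iff`).

Away from 0 this agrees with convergence of (x² ∧ 1) ν_n. At 0 the factor x² loses the mass of small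
jumps, and the atom γ_n δ₀ restores it, since γ_n = ∫ (x ∧ 1) dν_n - ν_n(1,∞); the last term
converges because ν has no atom at 1 (`tendsto_integral_tildeMeasure_iff`). -/

/-! ### Test functions with convergent integrals -/

/-- `f` is integrable for `νs n` and for `ν`, and its integrals converge. -/
structure IntegralTendsto (νs : ℕ → Measure ℝ) (ν : Measure ℝ) (f : ℝ → ℝ) : Prop where
  integrable_seq : ∀ n, Integrable f (νs n)
  integrable_lim : Integrable f ν
  tendsto : Tendsto (fun n => ∫ x, f x ∂νs n) atTop (𝓝 (∫ x, f x ∂ν))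

namespace IntegralTendsto

variable {νs : ℕ → Measure ℝ} {ν : Measure ℝ} {f g : ℝ → ℝ}

theorem add (hf : IntegralTendsto νs ν f) (hg : IntegralTendsto νs ν g) :
    IntegralTendsto νs ν (fun x => f x + g x) where
  integrable_seq n := (hf.integrable_seq n).add (hg.integrable_seq n)
  integrable_lim := hf.integrable_lim.add hg.integrable_lim
  tendsto := by
    simp_rw [fun n => integral_add (hf.integrable_seq n) (hg.integrable_seq n),
      integral_add hf.integrable_lim hg.integrable_lim]
    exact hf.tendsto.add hg.tendsto

theorem const_mul (c : ℝ) (hf : IntegralTendsto νs ν f) :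
    IntegralTendsto νs ν (fun x => c * f x) where
  integrable_seq n := (hf.integrable_seq n).const_mul c
  integrable_lim := hf.integrable_lim.const_mul c
  tendsto := by
    simp_rw [integral_const_mul]
    exact hf.tendsto.const_mul c

theorem sub (hf : IntegralTendsto νs ν f) (hg : IntegralTendsto νs ν g) :
    IntegralTendsto νs ν (fun x => f x - g x) := by
  simpa [sub_eq_add_neg] using hf.add (hg.const_mul (-1))

theorem finset_sum {ι : Type*} (s : Finset ι) {F : ι → ℝ → ℝ}
    (hF : ∀ i ∈ s, IntegralTendsto νs ν (F i)) :
    IntegralTendsto νs ν (fun x => ∑ i ∈ s, F i x) where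
  integrable_seq n := integrable_finsetSum s fun i hi => (hF i hi).integrable_seq n
  integrable_lim := integrable_finsetSum s fun i hi => (hF i hi).integrable_lim
  tendsto := by
    simp_rw [fun n => integral_finsetSum s fun i hi => (hF i hi).integrable_seq n,
      integral_finsetSum s fun i hi => (hF i hi).integrable_lim]
    exact tendsto_finsetSum s fun i hi => (hF i hi).tendsto

theorem congr_ae (hf : IntegralTendsto νs ν f) (hs : ∀ n, f =ᵐ[νs n] g) (h : f =ᵐ[ν] g) :
    IntegralTendsto νs ν g where
  integrable_seq n := (hf.integrable_seq n).congr (hs n)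
  integrable_lim := hf.integrable_lim.congr h
  tendsto := by
    simp_rw [fun n => integral_congr_ae (hs n).symm, integral_congr_ae h.symm]
    exact hf.tendsto

theorem congr_pos (hf : IntegralTendsto νs ν f) (hνs : ∀ n, νs n (Set.Iic 0) = 0)
    (hν : ν (Set.Iic 0) = 0) (h : ∀ x, 0 < x → f x = g x) : IntegralTendsto νs ν g := by
  have key : ∀ m : Measure ℝ, m (Set.Iic 0) = 0 → f =ᵐ[m] g := fun m hm => by
    filter_upwards [measure_eq_zero_iff_ae_notMem.1 hm] with x hx
    exact h x (by simpa using hx)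
  exact hf.congr_ae (fun n => key _ (hνs n)) (key _ hν)

/-- The functions with convergent integrals are closed under approximation by `g` with an error
`w` whose limiting integral is small. -/
theorem of_approx (hf : Measurable f)
    (h : ∀ ε > 0, ∃ g w, IntegralTendsto νs ν g ∧ IntegralTendsto νs ν w ∧
      (∀ n, ∀ᵐ x ∂νs n, |f x - g x| ≤ w x) ∧ (∀ᵐ x ∂ν, |f x - g x| ≤ w x) ∧
      ∫ x, w x ∂ν ≤ ε) : IntegralTendsto νs ν f := by
  have integ : ∀ (m : Measure ℝ) (g w : ℝ → ℝ), Integrable g m → Integrable w m →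
      (∀ᵐ x ∂m, |f x - g x| ≤ w x) → Integrable f m := by
    intro m g w hg hw hfg
    have : Integrable (fun x => f x - g x) m :=
      hw.mono' (hf.aestronglyMeasurable.sub hg.aestronglyMeasurable) hfg
    exact (this.add hg).congr (Eventually.of_forall fun x => by simp)
  have bound : ∀ (m : Measure ℝ) (g w : ℝ → ℝ), Integrable g m → Integrable w m →
      (∀ᵐ x ∂m, |f x - g x| ≤ w x) → |∫ x, f x ∂m - ∫ x, g x ∂m| ≤ ∫ x, w x ∂m := by
    intro m g w hg hw hfg
    rw [← integral_sub (integ m g w hg hw hfg) hg]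
    exact norm_integral_le_of_norm_le (f := fun x => f x - g x) hw hfg
  obtain ⟨g, w, hg, hw, hs, hl, -⟩ := h 1 one_pos
  refine ⟨fun n => integ _ g w (hg.integrable_seq n) (hw.integrable_seq n) (hs n),
    integ _ g w hg.integrable_lim hw.integrable_lim hl, ?_⟩
  rw [Metric.tendsto_atTop]
  intro ε hε
  -- Four quarters: one for the integrals of g, one for the limiting integral of w, two for its
  -- integral against `νs n`.
  obtain ⟨g, w, hg, hw, hs, hl, hε'⟩ := h (ε / 4) (by positivity)
  obtain ⟨N, hN⟩ := Metric.tendsto_atTop.1 hg.tendsto (ε / 4) (by positivity)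
  obtain ⟨M, hM⟩ := Metric.tendsto_atTop.1 hw.tendsto (ε / 4) (by positivity)
  refine ⟨max N M, fun n hn => ?_⟩
  have h1 := hN n (le_trans (le_max_left _ _) hn)
  have h2 := hM n (le_trans (le_max_right _ _) hn)
  have h3 := bound _ g w (hg.integrable_seq n) (hw.integrable_seq n) (hs n)
  have h4 := bound _ g w hg.integrable_lim hw.integrable_lim hl
  rw [Real.dist_eq, abs_lt] at *
  rw [abs_le] at h3 h4
  constructor <;> linarith [h1.1, h1.2, h2.1, h2.2, h3.1, h3.2, h4.1, h4.2]

theorem withDensity_iff {d : ℝ → ℝ} (hd : Measurable d) (hνs : ∀ n, ∀ᵐ x ∂νs n, 0 ≤ d x)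
    (hν : ∀ᵐ x ∂ν, 0 ≤ d x) :
    IntegralTendsto (fun n => (νs n).withDensity fun x => ENNReal.ofReal (d x))
      (ν.withDensity fun x => ENNReal.ofReal (d x)) f ↔
    IntegralTendsto νs ν (fun x => f x * d x) := by
  have hint : ∀ m : Measure ℝ, (∀ᵐ x ∂m, 0 ≤ d x) →
      ∫ x, f x ∂(m.withDensity fun x => ENNReal.ofReal (d x)) = ∫ x, f x * d x ∂m := by
    intro m hm
    rw [integral_withDensity_eq_integral_toReal_smul (by fun_prop) (by simp)]
    refine integral_congr_ae ?_
    filter_upwards [hm] with x hx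
    simp [hx, mul_comm]
  have hii : ∀ m : Measure ℝ, (∀ᵐ x ∂m, 0 ≤ d x) →
      (Integrable f (m.withDensity fun x => ENNReal.ofReal (d x)) ↔
        Integrable (fun x => f x * d x) m) := by
    intro m hm
    rw [integrable_withDensity_iff_integrable_smul' (by fun_prop) (by simp)]
    refine integrable_congr ?_
    filter_upwards [hm] with x hx
    simp [hx, mul_comm]
  constructor
  · rintro ⟨h1, h2, h3⟩
    refine ⟨fun n => (hii _ (hνs n)).1 (h1 n), (hii _ hν).1 h2, ?_⟩
    simpa only [fun n => hint _ (hνs n), hint _ hν] using h3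
  · rintro ⟨h1, h2, h3⟩
    refine ⟨fun n => (hii _ (hνs n)).2 (h1 n), (hii _ hν).2 h2, ?_⟩
    simpa only [fun n => hint _ (hνs n), hint _ hν] using h3

end IntegralTendsto

/-! ### Continuity theorem for Laplace transforms, and the mass of (1,∞) -/

/-- Continuity theorem for Laplace transforms of measures on `[0, ∞)`, sampled at the integers. -/
theorem integralTendsto_of_laplace {νs : ℕ → Measure ℝ} {ν : Measure ℝ} [IsFiniteMeasure ν]
    (hνs : ∀ n, ∀ᵐ x ∂νs n, 0 ≤ x) (hν : ∀ᵐ x ∂ν, 0 ≤ x)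
    (h : ∀ k : ℕ, IntegralTendsto νs ν (fun x => Real.exp (-(k * max x 0))))
    {f : ℝ → ℝ} (hf : Continuous f) {C : ℝ} (hC : ∀ x, |f x| ≤ C) :
    IntegralTendsto νs ν f := by
  have hone : IntegralTendsto νs ν (fun _ => 1) := by simpa using h 0
  have hcomp : ∀ g : ℝ → ℝ, Continuous g →
      IntegralTendsto νs ν (fun x => g (Real.exp (-(max x 0)))) := by
    intro g hg
    -- Approximate g uniformly on [0,1] by a polynomial in t = e^{-x}; the monomials t^i are the
    -- hypotheses. The 1 added to the mass of ν keeps the denominator positive.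
    refine IntegralTendsto.of_approx (by fun_prop) fun ε hε => ?_
    have hpos : 0 < 1 + ν.real Set.univ := by positivity
    obtain ⟨p, hp⟩ := exists_polynomial_near_of_continuousOn 0 1 g hg.continuousOn
      (ε / (1 + ν.real Set.univ)) (by positivity)
    refine ⟨fun x => p.eval (Real.exp (-(max x 0))), fun x => ε / (1 + ν.real Set.univ) * 1,
      ?_, hone.const_mul _, fun n => ?_, ?_, ?_⟩
    · simp_rw [Polynomial.eval_eq_sum_range]
      refine IntegralTendsto.finset_sum _ fun i _ => IntegralTendsto.const_mul _ ?_
      convert h i using 2 with x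
      rw [← Real.exp_nat_mul]
      ring_nf
    all_goals try
      refine Eventually.of_forall fun x => ?_
      have := hp (Real.exp (-(max x 0))) ⟨by positivity, by simp⟩
      rw [abs_sub_comm, mul_one]
      exact this.le
    rw [integral_const_mul, integral_const]
    simp only [smul_eq_mul, mul_one]
    rw [div_mul_eq_mul_div, div_le_iff₀ hpos]
    nlinarith
  have hsupp : ∀ (f : ℝ → ℝ) (R : ℝ), 0 ≤ R → Continuous f → (∀ x, R ≤ x → f x = 0) →
      IntegralTendsto νs ν f := by
    intro f R hR hf hfR
    -- Clamping t at e^{-R} avoids the singularity of log at 0 and changes nothing, as f vanishes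
    -- beyond R.
    have hc : Continuous fun t => f (-Real.log (max t (Real.exp (-R)))) := by
      refine hf.comp (Continuous.neg (Continuous.log (by fun_prop) fun t => ?_))
      exact (lt_of_lt_of_le (Real.exp_pos _) (le_max_right _ _)).ne'
    have key : ∀ x, 0 ≤ x → f (-Real.log (max (Real.exp (-(max x 0))) (Real.exp (-R)))) = f x := by
      intro x hx
      rw [max_eq_left hx]
      rcases le_total x R with hxR | hxR
      · rw [max_eq_left (Real.exp_le_exp.2 (by linarith)), Real.log_exp, neg_neg]
      · rw [max_eq_right (Real.exp_le_exp.2 (by linarith)), Real.log_exp, neg_neg, hfR x hxR,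
          hfR R le_rfl]
    exact (hcomp _ hc).congr_ae (fun n => (hνs n).mono key) (hν.mono key)
  have hC0 : 0 ≤ C := (abs_nonneg _).trans (hC 0)
  -- Tightness comes from convergence of the total masses: 1 - χ R also has convergent integrals,
  -- and its limiting integral is small for large R.
  set χ : ℕ → ℝ → ℝ := fun R x => max 0 (min 1 (R - x)) with hχ
  have hχc : ∀ R, Continuous (χ R) := fun R => by fun_prop
  have hχ0 : ∀ R x, 0 ≤ χ R x := fun R x => le_max_left _ _
  have hχ1 : ∀ R x, χ R x ≤ 1 := fun R x => max_le zero_le_one (min_le_left _ _)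
  have hχR : ∀ (R : ℕ) (x : ℝ), (R : ℝ) ≤ x → χ R x = 0 := fun R x hx =>
    max_eq_left ((min_le_right _ _).trans (by linarith))
  have hlim : Tendsto (fun R : ℕ => ∫ x, C * (1 - χ R x) ∂ν) atTop (𝓝 (∫ _, (0 : ℝ) ∂ν)) := by
    refine tendsto_integral_of_dominated_convergence (fun _ => C)
      (fun R => (by fun_prop : Continuous fun x => C * (1 - χ R x)).aestronglyMeasurable)
      (integrable_const _) (fun R => Eventually.of_forall fun x => ?_)
      (Eventually.of_forall fun x => ?_)
    · rw [Real.norm_eq_abs, abs_of_nonneg (mul_nonneg hC0 (by linarith [hχ1 R x]))]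
      nlinarith [hχ0 R x]
    · refine tendsto_const_nhds.congr' ?_
      filter_upwards [eventually_ge_atTop (⌈x⌉₊ + 1)] with R hR
      have h1 : x + 1 ≤ R := by
        have : ((⌈x⌉₊ + 1 : ℕ) : ℝ) ≤ R := by exact_mod_cast hR
        push_cast at this
        linarith [Nat.le_ceil x]
      have : χ R x = 1 := by
        simp only [hχ]
        rw [min_eq_left (by linarith), max_eq_right zero_le_one]
      simp [this]
  rw [integral_zero] at hlim
  refine IntegralTendsto.of_approx hf.measurable fun ε hε => ?_
  obtain ⟨R, hR⟩ := (hlim.eventually_le_const hε).exists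
  have happ : ∀ x, |f x - f x * χ R x| ≤ C * (1 - χ R x) := fun x => by
    rw [show f x - f x * χ R x = f x * (1 - χ R x) by ring, abs_mul,
      abs_of_nonneg (by linarith [hχ1 R x] : 0 ≤ 1 - χ R x)]
    exact mul_le_mul_of_nonneg_right (hC x) (by linarith [hχ1 R x])
  refine ⟨fun x => f x * χ R x, fun x => C * (1 - χ R x),
    hsupp _ R R.cast_nonneg (hf.mul (hχc R)) fun x hx => by simp [hχR R x hx],
    (hone.sub (hsupp _ R R.cast_nonneg (hχc R) (hχR R))).const_mul C,
    fun n => Eventually.of_forall happ, Eventually.of_forall happ, hR⟩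

/-- Convergence of the mass of `(1, ∞)` when the limit does not charge `1`. -/
theorem integralTendsto_indicator_Ioi_one {νs : ℕ → Measure ℝ} {ν : Measure ℝ}
    (h : ∀ f : ℝ → ℝ, Continuous f → (∃ C, ∀ x, |f x| ≤ C) → (∀ x ≤ 1 / 2, f x = 0) →
      IntegralTendsto νs ν f) (hν : ν {1} = 0) :
    IntegralTendsto νs ν ((Set.Ioi 1).indicator fun _ => 1) := by
  -- Tents at 1 that dominate the error of replacing the indicator by a continuous ramp. The slope m
  -- + 2 is at least 2, so they vanish for x ≤ 1/2.
  set w : ℕ → ℝ → ℝ := fun m x => max 0 (1 - (m + 2) * |x - 1|) with hw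
  have hwI : ∀ m, IntegralTendsto νs ν (w m) := fun m => by
    refine h _ (by fun_prop) ⟨1, fun x => ?_⟩ fun x hx => ?_
    · rw [abs_of_nonneg (le_max_left _ _)]
      refine max_le zero_le_one ?_
      have : 0 ≤ ((m : ℝ) + 2) * |x - 1| := by positivity
      linarith
    · refine max_eq_left ?_
      have h1 : 1 / 2 ≤ |x - 1| := by rw [abs_of_nonpos (by linarith)]; linarith
      have h2 : (0 : ℝ) ≤ m := m.cast_nonneg
      nlinarith
  have hlim : Tendsto (fun m => ∫ x, w m x ∂ν) atTop (𝓝 (∫ _, (0 : ℝ) ∂ν)) := by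
    refine tendsto_integral_of_dominated_convergence (w 0)
      (fun m => (hwI m).integrable_lim.aestronglyMeasurable) (hwI 0).integrable_lim
      (fun m => Eventually.of_forall fun x => ?_) ?_
    · rw [Real.norm_eq_abs, abs_of_nonneg (le_max_left _ _)]
      refine max_le_max le_rfl ?_
      have : 0 ≤ (m : ℝ) * |x - 1| := by positivity
      push_cast
      linarith
    · filter_upwards [measure_eq_zero_iff_ae_notMem.1 hν] with x hx
      have hx' : 0 < |x - 1| := abs_pos.2 (sub_ne_zero.2 (by simpa using hx))
      refine tendsto_const_nhds.congr' ?_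
      filter_upwards [eventually_ge_atTop ⌈|x - 1|⁻¹⌉₊] with m hm
      have h1 : |x - 1|⁻¹ ≤ m := (Nat.le_ceil _).trans (by exact_mod_cast hm)
      have h2 : 1 ≤ m * |x - 1| := by
        have := mul_le_mul_of_nonneg_right h1 hx'.le
        rwa [inv_mul_cancel₀ hx'.ne'] at this
      exact (max_eq_left (by nlinarith)).symm
  rw [integral_zero] at hlim
  refine IntegralTendsto.of_approx (measurable_const.indicator measurableSet_Ioi) fun ε hε => ?_
  obtain ⟨m, hm⟩ := (hlim.eventually_le_const hε).exists
  have hm0 : (0 : ℝ) ≤ m := m.cast_nonneg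
  have happ : ∀ x, |(Set.Ioi (1 : ℝ)).indicator (fun _ => (1 : ℝ)) x -
      max 0 (min 1 ((m + 2) * (x - 1)))| ≤ w m x := by
    intro x
    rcases le_or_gt x 1 with hx | hx
    · rw [Set.indicator_of_notMem (by simpa using hx),
        max_eq_left ((min_le_right _ _).trans (by nlinarith))]
      simp [hw]
    · rw [Set.indicator_of_mem (by simpa using hx)]
      simp only [hw]
      rw [abs_of_pos (sub_pos.2 hx), max_eq_right (le_min zero_le_one (by nlinarith))]
      rcases le_total 1 ((m + 2) * (x - 1)) with h1 | h1
      · rw [min_eq_left h1]; simp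
      · rw [min_eq_right h1, abs_of_nonneg (by linarith)]
        exact le_max_right _ _
  refine ⟨fun x => max 0 (min 1 ((m + 2) * (x - 1))), w m, h _ (by fun_prop) ⟨1, fun x => ?_⟩
    fun x hx => ?_, hwI m, fun n => Eventually.of_forall happ, Eventually.of_forall happ, hm⟩
  · rw [abs_of_nonneg (le_max_left _ _)]
    exact max_le zero_le_one (min_le_left _ _)
  · exact max_eq_left ((min_le_right _ _).trans (by nlinarith))

/-! ### Laplace exponents and the measures (x ∧ 1) ν -/

/-- `x ∧ 1` is a bounded continuous multiple of `1 - e^{-x}` on the half-line. -/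
theorem exists_min_one_eq_mul_one_sub_exp : ∃ r : ℝ → ℝ, Continuous r ∧
    (∀ x, 1 / 2 ≤ r x ∧ r x ≤ 2) ∧ ∀ x, 0 ≤ x → min x 1 = r x * (1 - Real.exp (-x)) := by
  set s : ℝ → ℝ := fun x => dslope (fun y => 1 - Real.exp (-y)) 0 (max x 0) with hs
  have hd : HasDerivAt (fun y => 1 - Real.exp (-y)) 1 0 := by
    have := ((hasDerivAt_neg (0 : ℝ)).exp).const_sub 1
    simpa using this
  have hsc : Continuous s := by
    have : Continuous (dslope (fun y : ℝ => 1 - Real.exp (-y)) 0) := by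
      rw [← continuousOn_univ, continuousOn_dslope univ_mem]
      exact ⟨by fun_prop, hd.differentiableAt⟩
    exact this.comp (by fun_prop)
  have hmul : ∀ x, 0 ≤ x → x * s x = 1 - Real.exp (-x) := fun x hx => by
    have := sub_smul_dslope (fun y : ℝ => 1 - Real.exp (-y)) 0 x
    simpa [hs, max_eq_left hx] using this
  have hs0 : ∀ x, x ≤ 0 → s x = 1 := fun x hx => by
    simp only [hs, max_eq_right hx, dslope_same, hd.deriv]
  -- This gives s ≥ 1/(1+x) ≥ 1/2 on (0,1] and 1 - e^{-x} ≥ x/(1+x) ≥ 1/2 on [1,∞), hence r ≤ 2.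
  have hlow : ∀ x, 0 ≤ x → x ≤ (1 + x) * (1 - Real.exp (-x)) := fun x hx => by
    have h1 := Real.add_one_le_exp x
    have h2 : Real.exp (-x) * Real.exp x = 1 := by rw [← Real.exp_add]; simp
    nlinarith [Real.exp_pos (-x)]
  have hup : ∀ x : ℝ, 1 - Real.exp (-x) ≤ x := fun x => by
    linarith [Real.add_one_le_exp (-x)]
  have hb : ∀ x, 1 / 2 ≤ max x 1 * s x ∧ max x 1 * s x ≤ 1 := by
    intro x
    rcases le_or_gt x 0 with hx | hx
    · rw [hs0 x hx, max_eq_right (by linarith)]; norm_num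
    · have e := hmul x hx.le
      have h1 := hlow x hx.le
      have h2 := hup x
      rcases le_total x 1 with hx1 | hx1
      · rw [max_eq_right hx1, one_mul]
        have hs1 : s x ≤ 1 := by nlinarith
        have : x * 1 ≤ x * ((1 + x) * s x) := by rw [← e] at h1; linarith
        have h3 := le_of_mul_le_mul_left this hx
        have : 0 < s x := by nlinarith
        exact ⟨by nlinarith, hs1⟩
      · rw [max_eq_left hx1, e]
        exact ⟨by nlinarith, by linarith [Real.exp_pos (-x)]⟩
  refine ⟨fun x => (max x 1 * s x)⁻¹, Continuous.inv₀ (by fun_prop) fun x => ?_, fun x => ⟨?_, ?_⟩,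
    fun x hx => ?_⟩
  · linarith [(hb x).1]
  · exact (by norm_num : (1 / 2 : ℝ) ≤ 1).trans (one_le_inv_iff₀.2 ⟨by linarith [(hb x).1], (hb x).2⟩)
  · rw [inv_le_comm₀ (by linarith [(hb x).1]) two_pos]
    linarith [(hb x).1]
  · have h0 : 0 < max x 1 * s x := by linarith [(hb x).1]
    rw [eq_inv_mul_iff_mul_eq₀ h0.ne', ← hmul x hx]
    have : max x 1 * min x 1 = x := by rw [max_mul_min]; simp
    calc max x 1 * s x * min x 1 = max x 1 * min x 1 * s x := by ring
      _ = x * s x := by rw [this]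

/-- Weak convergence of the measures `(x ∧ 1) ν_n(dx)`. -/
def MinOneTendsto (νs : ℕ → Measure ℝ) (ν : Measure ℝ) : Prop :=
  ∀ f : ℝ → ℝ, Continuous f → (∃ C, ∀ x, |f x| ≤ C) →
    IntegralTendsto νs ν (fun x => f x * min x 1)

section

variable {νs : ℕ → Measure ℝ} {ν : Measure ℝ}

/-- Convergence of the Laplace exponents at the integers amounts to weak convergence of the
measures `(x ∧ 1) ν_n(dx)`. -/
theorem laplaceExponent_tendsto_iff (hνs : ∀ n, νs n (Set.Iic 0) = 0) (hν : ν (Set.Iic 0) = 0) :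
    (∀ k : ℕ, IntegralTendsto νs ν (fun x => 1 - Real.exp (-(k * max x 0)))) ↔
      MinOneTendsto νs ν := by
  obtain ⟨r, hr, hr2, hre⟩ := exists_min_one_eq_mul_one_sub_exp
  have hr0 : ∀ x, 0 < r x := fun x => by linarith [(hr2 x).1]
  have hpos : ∀ m : Measure ℝ, m (Set.Iic 0) = 0 → ∀ᵐ x ∂m, 0 < x := fun m hm => by
    filter_upwards [measure_eq_zero_iff_ae_notMem.1 hm] with x hx
    simpa using hx
  constructor
  · intro h f hf ⟨C, hC⟩
    set d : ℝ → ℝ := fun x => 1 - Real.exp (-(max x 0)) with hd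
    have hdm : Measurable d := by fun_prop
    have hd0 : ∀ x, 0 ≤ d x := fun x => by simp [hd]
    have hdi : Integrable d ν := by simpa [hd] using (h 1).integrable_lim
    have hfin : IsFiniteMeasure (ν.withDensity fun x => ENNReal.ofReal (d x)) :=
      isFiniteMeasure_withDensity_ofReal hdi.2
    have hw : ∀ m : Measure ℝ, m (Set.Iic 0) = 0 →
        ∀ᵐ x ∂(m.withDensity fun x => ENNReal.ofReal (d x)), 0 ≤ x := fun m hm =>
      (withDensity_absolutelyContinuous _ _).ae_le ((hpos m hm).mono fun x hx => hx.le)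
    have key := integralTendsto_of_laplace (fun n => hw _ (hνs n)) (hw _ hν) (fun k => by
      rw [IntegralTendsto.withDensity_iff hdm (fun n => Eventually.of_forall hd0)
        (Eventually.of_forall hd0)]
      -- Telescoping: e^{-kx}(1 - e^{-x}) is the difference of the integrands of two consecutive
      -- exponents.
      refine ((h (k + 1)).sub (h k)).congr_pos hνs hν fun x hx => ?_
      simp only [hd, max_eq_left hx.le]
      rw [mul_sub, mul_one, ← Real.exp_add]
      push_cast
      ring_nf) (f := fun x => f x * r x) (by fun_prop) (C := C * 2) (fun x => by
        rw [abs_mul, abs_of_pos (hr0 x)]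
        exact mul_le_mul (hC x) (hr2 x).2 (hr0 x).le ((abs_nonneg _).trans (hC x)))
    rw [IntegralTendsto.withDensity_iff hdm (fun n => Eventually.of_forall hd0)
        (Eventually.of_forall hd0)] at key
    refine key.congr_pos hνs hν fun x hx => ?_
    simp only [hd, max_eq_left hx.le]
    rw [hre x hx.le]
    ring
  · intro h k
    induction k with
    | zero => simpa using (h (fun _ => 0) continuous_const ⟨0, by simp⟩)
    | succ k ih =>
      -- The same increment e^{-kx}(1 - e^{-x}), now read as the bounded continuous function
      -- e^{-kx}/r times x ∧ 1.
      have h1 := h (fun x => Real.exp (-(k * max x 0)) * (r x)⁻¹)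
        (Continuous.mul (by fun_prop) (hr.inv₀ fun x => (hr0 x).ne')) ⟨1 * 2, fun x => by
          rw [abs_mul, abs_of_pos (Real.exp_pos _), abs_of_pos (inv_pos.2 (hr0 x))]
          refine mul_le_mul ?_ ?_ (inv_pos.2 (hr0 x)).le zero_le_one
          · rw [Real.exp_le_one_iff, neg_nonpos]; positivity
          · rw [inv_le_comm₀ (hr0 x) two_pos]; linarith [(hr2 x).1]⟩
      refine (ih.add h1).congr_pos hνs hν fun x hx => ?_
      rw [hre x hx.le, max_eq_left hx.le, mul_assoc, inv_mul_cancel_left₀ (hr0 x).ne', mul_sub,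
        mul_one, ← Real.exp_add]
      push_cast
      ring_nf

/-! ### Comparison of (x ∧ 1) ν with γ δ₀ + (x² ∧ 1) ν -/

theorem integrable_min_one (hν : IsLevyMeasure ν) (h0 : ν (Set.Iic 0) = 0)
    (hi : IntegrableOn (fun x : ℝ => x) (Set.Ioc 0 1) ν) : Integrable (fun x => min x 1) ν := by
  have h1 : Integrable (fun x : ℝ => min (x ^ 2) 1) ν :=
    ⟨by fun_prop, by
      have := hν.lintegral_lt_top
      rwa [hasFiniteIntegral_iff_ofReal (Eventually.of_forall fun x => by positivity)]⟩
  have h2 : Integrable ((Set.Ioc 0 1).indicator fun x : ℝ => x) ν :=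
    (integrable_indicator_iff measurableSet_Ioc).2 hi
  refine (h1.add h2).mono' (by fun_prop) ?_
  filter_upwards [measure_eq_zero_iff_ae_notMem.1 h0] with x hx
  have hx : 0 < x := by simpa using hx
  have hm : 0 < min x 1 := lt_min hx one_pos
  rw [Real.norm_eq_abs, abs_of_pos hm, Pi.add_apply]
  rcases le_or_gt x 1 with h | h
  · rw [Set.indicator_of_mem (Set.mem_Ioc.2 ⟨hx, h⟩), min_eq_left h]
    have : 0 ≤ min (x ^ 2) 1 := by positivity
    linarith
  · rw [Set.indicator_of_notMem (by simp [h]), min_eq_right h.le, min_eq_right (by nlinarith)]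
    simp

theorem integral_tildeMeasure (hν : IsLevyMeasure ν) {γ : ℝ} (hγ : 0 ≤ γ) {f : ℝ → ℝ}
    (hf : Continuous f) {C : ℝ} (hC : ∀ x, |f x| ≤ C) :
    ∫ x, f x ∂tildeMeasure γ ν = γ * f 0 + ∫ x, f x * min (x ^ 2) 1 ∂ν := by
  have : IsFiniteMeasure (ν.withDensity (fun x => ENNReal.ofReal (min (x ^ 2) 1))) :=
    isFiniteMeasure_withDensity hν.lintegral_lt_top.ne
  have hd : Measurable fun x : ℝ => ENNReal.ofReal (min (x ^ 2) 1) := by fun_prop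
  rw [tildeMeasure, integral_add_measure, integral_smul_measure, integral_dirac,
    ENNReal.toReal_ofReal hγ, smul_eq_mul, integral_withDensity_eq_integral_toReal_smul hd (by simp)]
  · congr 2
    ext x
    rw [ENNReal.toReal_ofReal (by positivity), smul_eq_mul, mul_comm]
  · exact Integrable.smul_measure (integrable_dirac (by simp)) ENNReal.ofReal_ne_top
  · exact Integrable.of_bound hf.aestronglyMeasurable C (Eventually.of_forall hC)

/-- Expresses γ through x ∧ 1 and the mass of (1,∞), whose convergence can be controlled separately.
-/
theorem setIntegral_Ioc_eq (h0 : ν (Set.Iic 0) = 0) :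
    ∫ x in Set.Ioc 0 1, x ∂ν =
      ∫ x, (min x 1 - (Set.Ioi 1).indicator (fun _ => 1) x) ∂ν := by
  rw [← integral_indicator measurableSet_Ioc]
  refine integral_congr_ae ?_
  filter_upwards [measure_eq_zero_iff_ae_notMem.1 h0] with x hx
  have hx : 0 < x := by simpa using hx
  rcases le_or_gt x 1 with h | h
  · rw [Set.indicator_of_mem (Set.mem_Ioc.2 ⟨hx, h⟩), min_eq_left h, Set.indicator_of_notMem (by simpa using h),
      sub_zero]
  · rw [Set.indicator_of_notMem (by simp [h]), min_eq_right h.le, Set.indicator_of_mem (Set.mem_Ioi.2 h), sub_self]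

/-- Away from 0 the weight is harmless: f may be divided by (x ∨ ε) ∧ 1, which is bounded below by ε
∧ 1 and equals x ∧ 1 where f is nonzero. -/
theorem MinOneTendsto.of_vanishing (h : MinOneTendsto νs ν) {ε : ℝ} (hε : 0 < ε) {f : ℝ → ℝ}
    (hf : Continuous f) {C : ℝ} (hC : ∀ x, |f x| ≤ C) (h0 : ∀ x ≤ ε, f x = 0) :
    IntegralTendsto νs ν f := by
  have hp : ∀ x, 0 < min (max x ε) 1 := fun x => by positivity
  have hq : ∀ x, min ε 1 ≤ min (max x ε) 1 := fun x => min_le_min_right _ (le_max_right _ _)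
  have := h (fun x => f x / min (max x ε) 1) (hf.div (by fun_prop) fun x => (hp x).ne')
    ⟨C / min ε 1, fun x => by
      rw [abs_div, abs_of_pos (hp x)]
      exact div_le_div₀ ((abs_nonneg _).trans (hC x)) (hC x) (by positivity) (hq x)⟩
  convert this using 2 with x
  rcases le_or_gt x ε with hx | hx
  · simp [h0 x hx]
  · rw [max_eq_left hx.le, div_mul_cancel₀]
    have := hp x
    rw [max_eq_left hx.le] at this
    exact this.ne'

/-- Weak convergence of the measures `γ_n δ₀ + (x² ∧ 1) ν_n(dx)` amounts to weak convergence of the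
measures `(x ∧ 1) ν_n(dx)`. -/
theorem tendsto_integral_tildeMeasure_iff {γs : ℕ → ℝ} {γ : ℝ}
    (hLs : ∀ n, IsLevyMeasure (νs n)) (hL : IsLevyMeasure ν)
    (hνs : ∀ n, νs n (Set.Iic 0) = 0) (hν : ν (Set.Iic 0) = 0)
    (hi : ∀ n, Integrable (fun x => min x 1) (νs n)) (hi' : Integrable (fun x => min x 1) ν)
    (hγs : ∀ n, γs n = ∫ x in Set.Ioc 0 1, x ∂(νs n)) (hγ : γ = ∫ x in Set.Ioc 0 1, x ∂ν)
    (hν1 : ν {1} = 0) :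
    (∀ f : ℝ → ℝ, Continuous f → (∃ C, ∀ x, |f x| ≤ C) →
      Tendsto (fun n => ∫ x, f x ∂tildeMeasure (γs n) (νs n)) atTop
        (𝓝 (∫ x, f x ∂tildeMeasure γ ν))) ↔ MinOneTendsto νs ν := by
  have hγ0 : 0 ≤ γ := hγ ▸ setIntegral_nonneg measurableSet_Ioc fun x hx => hx.1.le
  have hγs0 : ∀ n, 0 ≤ γs n := fun n =>
    hγs n ▸ setIntegral_nonneg measurableSet_Ioc fun x hx => hx.1.le
  constructor
  · intro h
    have hsq : ∀ m : Measure ℝ, m (Set.Iic 0) = 0 → Integrable (fun x => min x 1) m →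
        ∀ f : ℝ → ℝ, Continuous f → ∀ C, (∀ x, |f x| ≤ C) →
        Integrable (fun x => f x * min (x ^ 2) 1) m := by
      intro m hm hmi f hf C hC
      refine (hmi.const_mul C).mono' (by fun_prop) ?_
      filter_upwards [measure_eq_zero_iff_ae_notMem.1 hm] with x hx
      have hx : 0 < x := by simpa using hx
      rw [Real.norm_eq_abs, abs_mul, abs_of_pos (by positivity : 0 < min (x ^ 2) 1)]
      refine mul_le_mul (hC x) ?_ (by positivity) ((abs_nonneg _).trans (hC x))
      rcases le_total x 1 with h1 | h1
      · rw [min_eq_left h1]; exact (min_le_left _ _).trans (by nlinarith)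
      · rw [min_eq_right h1]; exact min_le_right _ _
    have htend : ∀ f : ℝ → ℝ, Continuous f → (∃ C, ∀ x, |f x| ≤ C) →
        Tendsto (fun n => γs n * f 0 + ∫ x, f x * min (x ^ 2) 1 ∂νs n) atTop
          (𝓝 (γ * f 0 + ∫ x, f x * min (x ^ 2) 1 ∂ν)) := by
      intro f hf ⟨C, hC⟩
      have := h f hf ⟨C, hC⟩
      simpa only [fun n => integral_tildeMeasure (hLs n) (hγs0 n) hf hC,
        integral_tildeMeasure hL hγ0 hf hC] using this
    have hvan : ∀ ε > 0, ∀ f : ℝ → ℝ, Continuous f → (∃ C, ∀ x, |f x| ≤ C) →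
        (∀ x ≤ ε, f x = 0) → IntegralTendsto νs ν f := by
      intro ε hε f hf ⟨C, hC⟩ h0
      -- f/q is bounded and continuous and vanishes at 0, so testing with it misses the atom there
      -- and recovers the integral of f.
      set q : ℝ → ℝ := fun x => min (max x ε ^ 2) 1 with hq
      have hp : ∀ x, 0 < q x := fun x => by positivity
      have hqε : ∀ x, min (ε ^ 2) 1 ≤ q x := fun x =>
        min_le_min_right _ (pow_le_pow_left₀ hε.le (le_max_right _ _) _)
      have hc : Continuous fun x => f x / q x := hf.div (by fun_prop) fun x => (hp x).ne'
      have hb : ∀ x, |f x / q x| ≤ C / min (ε ^ 2) 1 := fun x => by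
        rw [abs_div, abs_of_pos (hp x)]
        exact div_le_div₀ ((abs_nonneg _).trans (hC x)) (hC x) (by positivity) (hqε x)
      have heq : ∀ x, f x / q x * min (x ^ 2) 1 = f x := fun x => by
        rcases le_or_gt x ε with hx | hx
        · simp [h0 x hx]
        · have h2 : q x = min (x ^ 2) 1 := by simp only [hq, max_eq_left hx.le]
          rw [← h2, div_mul_cancel₀ _ (hp x).ne']
      have h3 := htend _ hc ⟨_, hb⟩
      have h4 := fun m hm hmi => hsq m hm hmi _ hc _ hb
      simp only [heq, h0 0 hε.le, zero_div, mul_zero, zero_add] at h3 h4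
      exact ⟨fun n => h4 _ (hνs n) (hi n), h4 _ hν hi', h3⟩
    have hγlim : Tendsto γs atTop (𝓝 γ) := by
      have h1 := htend (fun _ => 1) continuous_const ⟨1, by simp⟩
      simp only [mul_one, one_mul] at h1
      obtain ⟨M, hM⟩ := h1.bddAbove_range
      have hγM : ∀ n, γs n ≤ M := fun n => by
        have := hM ⟨n, rfl⟩
        have h2 : 0 ≤ ∫ x, min (x ^ 2) 1 ∂νs n := integral_nonneg fun x => by positivity
        simp only at this
        linarith
      rw [Metric.tendsto_atTop]
      intro ε hε
      have hM0 : 0 ≤ M := (hγs0 0).trans (hγM 0)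
      -- A cutoff c with c(0) = 1, vanishing beyond δ, isolates the atom: as x² ≤ δ x on (0,δ), its
      -- integral against (x² ∧ 1) ν_n lies in [0, δ γ_n], and γ_n ≤ M. The choice of δ keeps the
      -- two errors, for ν_n and ν, within ε/2 together.
      obtain ⟨δ, hδ0, hδ1, hδ⟩ : ∃ δ : ℝ, 0 < δ ∧ δ ≤ 1 ∧ δ * (M + γ) ≤ ε / 2 := by
        refine ⟨min 1 (ε / 2 / (M + γ + 1)), by positivity, min_le_left _ _, ?_⟩
        have : min 1 (ε / 2 / (M + γ + 1)) * (M + γ + 1) ≤ ε / 2 := by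
          rw [← le_div_iff₀ (by positivity)]; exact min_le_right _ _
        have h3 : 0 ≤ min 1 (ε / 2 / (M + γ + 1)) := by positivity
        nlinarith
      set c : ℝ → ℝ := fun x => max 0 (min 1 (1 - x / δ)) with hc
      have hc0 : c 0 = 1 := by simp [hc]
      have hcn : ∀ x, 0 ≤ c x := fun x => le_max_left _ _
      have hc1 : ∀ x, c x ≤ 1 := fun x => max_le zero_le_one (min_le_left _ _)
      have hcb : ∀ x, |c x| ≤ 1 := fun x => by rw [abs_of_nonneg (hcn x)]; exact hc1 x
      have hcc : Continuous c := by fun_prop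
      have h2 := htend c hcc ⟨1, hcb⟩
      simp only [hc0, mul_one] at h2
      obtain ⟨N, hN⟩ := Metric.tendsto_atTop.1 h2 (ε / 2) (by positivity)
      have herr : ∀ m : Measure ℝ, m (Set.Iic 0) = 0 → Integrable (fun x => min x 1) m →
          0 ≤ ∫ x, c x * min (x ^ 2) 1 ∂m ∧
          ∫ x, c x * min (x ^ 2) 1 ∂m ≤ δ * ∫ x in Set.Ioc 0 1, x ∂m := by
        intro m hm hmi
        refine ⟨integral_nonneg fun x => mul_nonneg (hcn x) (by positivity), ?_⟩
        have hii : IntegrableOn (fun x : ℝ => x) (Set.Ioc 0 1) m :=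
          (hmi.integrableOn (s := Set.Ioc 0 1)).congr_fun
            (fun x hx => min_eq_left hx.2) measurableSet_Ioc
        rw [← integral_indicator measurableSet_Ioc, ← integral_const_mul]
        refine integral_mono_ae (hsq m hm hmi c hcc 1 hcb)
          (((integrable_indicator_iff measurableSet_Ioc).2 hii).const_mul δ) ?_
        filter_upwards [measure_eq_zero_iff_ae_notMem.1 hm] with x hx
        have hx : 0 < x := by simpa using hx
        rcases le_or_gt δ x with hxδ | hxδ
        · have : c x = 0 := max_eq_left ((min_le_right _ _).trans (by
            rw [sub_nonpos, one_le_div hδ0]; exact hxδ))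
          rw [this, zero_mul]
          exact mul_nonneg hδ0.le (Set.indicator_nonneg (fun y hy => hy.1.le) _)
        · rw [Set.indicator_of_mem (Set.mem_Ioc.2 ⟨hx, by linarith⟩)]
          calc c x * min (x ^ 2) 1 ≤ 1 * x ^ 2 :=
                mul_le_mul (hc1 x) (min_le_left _ _) (by positivity) zero_le_one
            _ ≤ δ * x := by nlinarith
      refine ⟨N, fun n hn => ?_⟩
      have h3 := hN n hn
      have h4 := herr _ (hνs n) (hi n)
      have h5 := herr _ hν hi'
      rw [← hγs] at h4
      rw [← hγ] at h5
      rw [Real.dist_eq, abs_lt] at *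
      have := hγM n
      constructor <;> nlinarith
    -- The missing atom at 1 is used here; adding the mass of (1,∞) to γ_n then gives the full mass
    -- of (x ∧ 1) ν_n.
    have hIoi : IntegralTendsto νs ν ((Set.Ioi 1).indicator fun _ => 1) :=
      integralTendsto_indicator_Ioi_one (hvan (1 / 2) (by norm_num)) hν1
    have hmin : IntegralTendsto νs ν (fun x => min x 1) := by
      refine ⟨hi, hi', ?_⟩
      have hs : ∀ n, γs n + ∫ x, (Set.Ioi 1).indicator (fun _ => 1) x ∂νs n =
          ∫ x, min x 1 ∂νs n := fun n => by
        rw [hγs n, setIntegral_Ioc_eq (hνs n), integral_sub (hi n) (hIoi.integrable_seq n),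
          sub_add_cancel]
      have hl : γ + ∫ x, (Set.Ioi 1).indicator (fun _ => 1) x ∂ν = ∫ x, min x 1 ∂ν := by
        rw [hγ, setIntegral_Ioc_eq hν, integral_sub hi' hIoi.integrable_lim, sub_add_cancel]
      simpa only [hs, hl] using hγlim.add hIoi.tendsto
    intro f hf ⟨C, hC⟩
    -- Near 0 the factor f - f(0) is below η, so removing a neighbourhood of 0 costs at most η ∫ (x
    -- ∧ 1); the rest vanishes near 0.
    have hdiff : IntegralTendsto νs ν (fun x => (f x - f 0) * min x 1) := by
      refine IntegralTendsto.of_approx (by fun_prop) fun ε hε => ?_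
      have hI0 : 0 ≤ ∫ x, min x 1 ∂ν := integral_nonneg_of_ae (by
        filter_upwards [measure_eq_zero_iff_ae_notMem.1 hν] with x hx
        have hx : 0 < x := by simpa using hx
        exact (lt_min hx one_pos).le)
      obtain ⟨η, hη0, hη⟩ : ∃ η > 0, η * ∫ x, min x 1 ∂ν ≤ ε := by
        refine ⟨ε / (1 + ∫ x, min x 1 ∂ν), by positivity, ?_⟩
        rw [div_mul_eq_mul_div, div_le_iff₀ (by positivity)]
        nlinarith
      obtain ⟨δ, hδ0, hδ⟩ := Metric.continuous_iff.1 hf 0 η hη0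
      set c : ℝ → ℝ := fun x => max 0 (min 1 (2 * x / δ - 1)) with hc
      have hcn : ∀ x, 0 ≤ c x := fun x => le_max_left _ _
      have hc1 : ∀ x, c x ≤ 1 := fun x => max_le zero_le_one (min_le_left _ _)
      have happ : ∀ m : Measure ℝ, m (Set.Iic 0) = 0 →
          ∀ᵐ x ∂m, |(f x - f 0) * min x 1 - (f x - f 0) * min x 1 * c x| ≤ η * min x 1 := by
        intro m hm
        filter_upwards [measure_eq_zero_iff_ae_notMem.1 hm] with x hx
        have hx : 0 < x := by simpa using hx
        have hx1 : 0 < min x 1 := lt_min hx one_pos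
        rw [show (f x - f 0) * min x 1 - (f x - f 0) * min x 1 * c x
          = (f x - f 0) * (1 - c x) * min x 1 by ring, abs_mul, abs_of_pos hx1]
        refine mul_le_mul_of_nonneg_right ?_ hx1.le
        rw [abs_mul, abs_of_nonneg (by linarith [hc1 x] : 0 ≤ 1 - c x)]
        rcases lt_or_ge x δ with h1 | h1
        · have := hδ x (by rwa [Real.dist_eq, sub_zero, abs_of_pos hx])
          rw [Real.dist_eq] at this
          nlinarith [hcn x, abs_nonneg (f x - f 0)]
        · have : c x = 1 := by
            have : 1 ≤ 2 * x / δ - 1 := by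
              rw [le_sub_iff_add_le, le_div_iff₀ hδ0]; linarith
            simp only [hc]
            rw [min_eq_left this, max_eq_right zero_le_one]
          rw [this]
          simp [hη0.le]
      refine ⟨fun x => (f x - f 0) * min x 1 * c x, fun x => η * min x 1,
        hvan (min (δ / 2) 1) (by positivity) _ (by fun_prop) ⟨(C + C) * 1 * 1, fun x => ?_⟩
          fun x hx => ?_,
        hmin.const_mul η, fun n => happ _ (hνs n), happ _ hν, ?_⟩
      · have hC0 : 0 ≤ C := (abs_nonneg _).trans (hC 0)
        -- x ∧ 1 is unbounded on the negative half-line, but c is zero there.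
        rcases le_or_gt x 0 with hx | hx
        · have : c x = 0 := by
            refine max_eq_left ((min_le_right _ _).trans ?_)
            have : 2 * x / δ ≤ 0 := div_nonpos_of_nonpos_of_nonneg (by linarith) hδ0.le
            linarith
          rw [this]
          simp only [mul_zero, abs_zero]
          positivity
        · rw [abs_mul, abs_mul, abs_of_nonneg (hcn x), abs_of_pos (lt_min hx one_pos)]
          have : |f x - f 0| ≤ C + C := (abs_sub _ _).trans (add_le_add (hC x) (hC 0))
          have h3 : 0 < min x 1 := lt_min hx one_pos
          exact mul_le_mul (mul_le_mul this (min_le_right _ _) h3.le (by positivity)) (hc1 x)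
            (hcn x) (by positivity)
      · have : c x = 0 := by
          refine max_eq_left ((min_le_right _ _).trans ?_)
          rw [sub_nonpos, div_le_one hδ0]
          linarith [hx.trans (min_le_left _ _)]
        rw [this, mul_zero]
      · rw [integral_const_mul]; exact hη
    refine (hdiff.add (hmin.const_mul (f 0))).congr_pos hνs hν fun x _ => ?_
    ring
  · intro h f hf ⟨C, hC⟩
    simp only [fun n => integral_tildeMeasure (hLs n) (hγs0 n) hf hC,
        integral_tildeMeasure hL hγ0 hf hC]
    have hIoi : IntegralTendsto νs ν ((Set.Ioi 1).indicator fun _ => 1) :=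
      integralTendsto_indicator_Ioi_one (fun f hf ⟨C, hC⟩ h0 =>
        h.of_vanishing (by norm_num) hf hC h0) hν1
    have hmin : IntegralTendsto νs ν (fun x => min x 1) := by
      simpa using h (fun _ => 1) continuous_const ⟨1, by simp⟩
    refine Tendsto.add ?_ ?_
    · simp only [hγs, hγ, fun n => setIntegral_Ioc_eq (hνs n), setIntegral_Ioc_eq hν]
      exact (hmin.sub hIoi).tendsto.mul_const _
    -- For x > 0, x² ∧ 1 = (|x| ∧ 1)(x ∧ 1); the absolute value keeps the test function bounded on
    -- the whole line.
    · refine IntegralTendsto.tendsto ((h (fun x => f x * min |x| 1) (by fun_prop) ⟨C * 1, fun x => ?_⟩).congr_pos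
        hνs hν fun x hx => ?_)
      · rw [abs_mul, abs_of_nonneg (by positivity : 0 ≤ min |x| 1)]
        exact mul_le_mul (hC x) (min_le_right _ _) (by positivity) ((abs_nonneg _).trans (hC x))
      · rw [abs_of_pos hx]
        rcases le_total x 1 with h1 | h1
        · rw [min_eq_left h1, min_eq_left (by nlinarith)]; ring
        · rw [min_eq_right h1, min_eq_right (by nlinarith)]; ring

end

/-! ### Compound Poisson laws -/

/-- Convolution powers of a measure on the line. -/
noncomputable def convPow (m : Measure ℝ) : ℕ → Measure ℝ
  | 0 => Measure.dirac 0
  | n + 1 => (convPow m n).conv m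

/-- The compound Poisson law with finite jump measure `m`. -/
noncomputable def compoundPoisson (m : Measure ℝ) : Measure ℝ :=
  Measure.sum fun k : ℕ =>
    ENNReal.ofReal (Real.exp (-m.real Set.univ) / (k.factorial : ℝ)) • convPow m k

section

variable {m : Measure ℝ} [IsFiniteMeasure m]

instance isFiniteMeasure_convPow (n : ℕ) : IsFiniteMeasure (convPow m n) := by
  induction n with
  | zero => rw [convPow]; infer_instance
  | succ n ih => rw [convPow]; infer_instance

theorem ae_nonneg_convPow (hm : ∀ᵐ x ∂m, 0 ≤ x) (n : ℕ) : ∀ᵐ x ∂convPow m n, 0 ≤ x := by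
  induction n with
  | zero => simp [convPow, ae_dirac_eq]
  | succ n ih =>
    rw [convPow, Measure.conv, ae_map_iff (by fun_prop) measurableSet_Ici,
      Measure.ae_prod_iff_ae_ae (measurableSet_le measurable_const (by fun_prop))]
    filter_upwards [ih] with x hx
    filter_upwards [hm] with y hy
    exact add_nonneg hx hy

/-- Multiplicativity is asked only on [0,∞), so that h may be e^{izx} as well as e^{-k max(x,0)}. -/
theorem integral_convPow (hm : ∀ᵐ x ∂m, 0 ≤ x) {h : ℝ → ℂ} (hh : Measurable h)
    (hb : ∀ x, 0 ≤ x → ‖h x‖ ≤ 1) (h0 : h 0 = 1)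
    (hmul : ∀ x y, 0 ≤ x → 0 ≤ y → h (x + y) = h x * h y) (n : ℕ) :
    ∫ x, h x ∂convPow m n = (∫ x, h x ∂m) ^ n := by
  induction n with
  | zero => simp [convPow, h0]
  | succ n ih =>
    have hint : Integrable h ((convPow m n).conv m) :=
      Integrable.of_bound hh.aestronglyMeasurable 1 ((ae_nonneg_convPow hm (n + 1)).mono hb)
    rw [convPow, integral_conv hint, pow_succ, ← ih, ← integral_mul_const]
    refine integral_congr_ae ?_
    filter_upwards [ae_nonneg_convPow hm n] with x hx
    rw [← integral_const_mul]
    refine integral_congr_ae ?_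
    filter_upwards [hm] with y hy
    exact hmul x y hx hy

theorem convPow_univ (n : ℕ) : convPow m n Set.univ = m Set.univ ^ n := by
  induction n with
  | zero => simp [convPow]
  | succ n ih =>
    rw [convPow, Measure.conv, Measure.map_apply (by fun_prop) MeasurableSet.univ,
      Set.preimage_univ, Measure.prod_apply MeasurableSet.univ]
    simp [ih, pow_succ, mul_comm]

instance isProbabilityMeasure_compoundPoisson : IsProbabilityMeasure (compoundPoisson m) := by
  constructor
  rw [compoundPoisson, Measure.sum_apply _ MeasurableSet.univ]
  set c := m.real Set.univ with hc
  have hc0 : 0 ≤ c := measureReal_nonneg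
  have hmc : m Set.univ = ENNReal.ofReal c := by rw [hc, ofReal_measureReal]
  have hsum : HasSum (fun k : ℕ => Real.exp (-c) * (c ^ k / (k.factorial : ℝ))) 1 := by
    have := (NormedSpace.expSeries_div_hasSum_exp c).mul_left (Real.exp (-c))
    rwa [← Real.exp_eq_exp_ℝ, ← Real.exp_add, neg_add_cancel, Real.exp_zero] at this
  have hterm : ∀ k : ℕ, (ENNReal.ofReal (Real.exp (-c) / (k.factorial : ℝ)) • convPow m k)
      Set.univ = ENNReal.ofReal (Real.exp (-c) * (c ^ k / (k.factorial : ℝ))) := fun k => by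
    rw [Measure.smul_apply, convPow_univ, hmc, smul_eq_mul, ← ENNReal.ofReal_pow hc0,
      ← ENNReal.ofReal_mul (by positivity)]
    ring_nf
  simp_rw [hterm]
  rw [← ENNReal.ofReal_tsum_of_nonneg (fun k => by positivity) hsum.summable, hsum.tsum_eq,
    ENNReal.ofReal_one]

theorem ae_nonneg_compoundPoisson (hm : ∀ᵐ x ∂m, 0 ≤ x) : ∀ᵐ x ∂compoundPoisson m, 0 ≤ x := by
  rw [compoundPoisson, Measure.ae_sum_iff]
  exact fun k => Measure.ae_smul_measure (ae_nonneg_convPow hm k) _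

/-- The k-th term contributes e^{-m(ℝ)} (∫ h dm)^k / k!, and the exponential series sums these. One
formula thus yields both the characteristic function and the Laplace transform. -/
theorem integral_compoundPoisson (hm : ∀ᵐ x ∂m, 0 ≤ x) {h : ℝ → ℂ} (hh : Measurable h)
    (hb : ∀ x, 0 ≤ x → ‖h x‖ ≤ 1) (h0 : h 0 = 1)
    (hmul : ∀ x y, 0 ≤ x → 0 ≤ y → h (x + y) = h x * h y) :
    ∫ x, h x ∂compoundPoisson m = Complex.exp (∫ x, (h x - 1) ∂m) := by
  have hint : Integrable h (compoundPoisson m) :=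
    Integrable.of_bound hh.aestronglyMeasurable 1 ((ae_nonneg_compoundPoisson hm).mono hb)
  have hintm : Integrable h m := Integrable.of_bound hh.aestronglyMeasurable 1 (hm.mono hb)
  have h1 := hasSum_integral_measure hint
  have h2 := (NormedSpace.expSeries_div_hasSum_exp (∫ x, h x ∂m)).mul_left
    (Complex.exp (-(m.real Set.univ : ℂ)))
  rw [integral_sub hintm (integrable_const _), integral_const]
  rw [← Complex.exp_eq_exp_ℂ, ← Complex.exp_add] at h2
  have h3 : (m.real Set.univ • (1 : ℂ)) = (m.real Set.univ : ℂ) := by simp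
  rw [h3, sub_eq_neg_add]
  refine h1.unique ?_
  refine (congrArg (fun F => HasSum F _) (funext fun k => ?_)).mpr h2
  rw [integral_smul_measure, integral_convPow hm hh hb h0 hmul,
    ENNReal.toReal_ofReal (by positivity), Complex.real_smul]
  push_cast
  ring

end

/-! ### From characteristic functions to Laplace transforms -/

theorem tendsto_setIntegral_Ioi_inv {E : Type*} [NormedAddCommGroup E] [NormedSpace ℝ E]
    {ν : Measure ℝ} (h0 : ν (Set.Iic 0) = 0) {g : ℝ → E} (hg : Integrable g ν) :
    Tendsto (fun j : ℕ => ∫ x in Set.Ioi (1 / ((j : ℝ) + 1)), g x ∂ν) atTop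
      (𝓝 (∫ x, g x ∂ν)) := by
  have hU : ⋃ j : ℕ, Set.Ioi (1 / ((j : ℝ) + 1)) = Set.Ioi 0 := by
    ext x
    simp only [Set.mem_iUnion, Set.mem_Ioi]
    exact ⟨fun ⟨j, hj⟩ => lt_trans (by positivity) hj, fun hx => exists_nat_one_div_lt hx⟩
  have := tendsto_setIntegral_of_monotone (μ := ν) (f := g)
    (s := fun j : ℕ => Set.Ioi (1 / ((j : ℝ) + 1))) (fun _ => measurableSet_Ioi)
    (fun i j hij => Set.Ioi_subset_Ioi (Nat.one_div_le_one_div hij)) hg.integrableOn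
  rw [hU] at this
  have hr : ν.restrict (Set.Ioi 0) = ν := by
    refine Measure.restrict_eq_self_of_ae_mem ?_
    filter_upwards [measure_eq_zero_iff_ae_notMem.1 h0] with x hx
    simpa using hx
  rwa [hr] at this

theorem norm_cexp_mul_I_sub_one_le (z : ℝ) {x : ℝ} (hx : 0 < x) :
    ‖Complex.exp (Complex.I * z * x) - 1‖ ≤ (|z| + 2) * min x 1 := by
  have e : Complex.I * (z : ℂ) * x = Complex.I * ((z * x : ℝ) : ℂ) := by push_cast; ring
  rw [e]
  rcases le_total x 1 with h | h
  · rw [min_eq_left h]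
    refine (Real.norm_exp_I_mul_ofReal_sub_one_le).trans ?_
    rw [Real.norm_eq_abs, abs_mul, abs_of_pos hx]
    nlinarith
  · rw [min_eq_right h]
    refine (norm_sub_le _ _).trans ?_
    rw [Complex.norm_exp_I_mul_ofReal, norm_one]
    nlinarith [abs_nonneg z]

theorem integrable_cexp_sub_one {ν : Measure ℝ} (h0 : ν (Set.Iic 0) = 0)
    (hi : Integrable (fun x => min x 1) ν) (z : ℝ) :
    Integrable (fun x : ℝ => Complex.exp (Complex.I * z * x) - 1) ν := by
  refine (hi.const_mul (|z| + 2)).mono' (by fun_prop) ?_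
  filter_upwards [measure_eq_zero_iff_ae_notMem.1 h0] with x hx
  exact norm_cexp_mul_I_sub_one_le z (by simpa using hx)

theorem integrable_one_sub_exp {ν : Measure ℝ} (h0 : ν (Set.Iic 0) = 0)
    (hi : Integrable (fun x => min x 1) ν) (k : ℕ) :
    Integrable (fun x : ℝ => 1 - Real.exp (-(k * max x 0))) ν := by
  refine (hi.const_mul (k + 1)).mono' (by fun_prop) ?_
  filter_upwards [measure_eq_zero_iff_ae_notMem.1 h0] with x hx
  have hx : 0 < x := by simpa using hx
  rw [max_eq_left hx.le]
  have h1 := Real.add_one_le_exp (-(k * x))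
  have h2 : Real.exp (-(k * x)) ≤ 1 := by rw [Real.exp_le_one_iff, neg_nonpos]; positivity
  have h3 := Real.exp_pos (-(k * x))
  rw [Real.norm_eq_abs, abs_of_nonneg (by linarith)]
  rcases le_total x 1 with h | h
  · rw [min_eq_left h]; nlinarith
  · rw [min_eq_right h]
    have : (0 : ℝ) ≤ k := k.cast_nonneg
    linarith

/-- A law with the characteristic function of a driftless subordinator lives on `[0, ∞)` and has
the corresponding Laplace transform. -/
theorem laplace_of_charFun {Q : ProbabilityMeasure ℝ} {ν : Measure ℝ} (h0 : ν (Set.Iic 0) = 0)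
    (hi : Integrable (fun x => min x 1) ν)
    (hQ : ∀ z : ℝ, charFun (Q : Measure ℝ) z =
      Complex.exp (∫ x : ℝ, (Complex.exp (Complex.I * z * x) - 1) ∂ν)) :
    (∀ᵐ x ∂(Q : Measure ℝ), 0 ≤ x) ∧ ∀ k : ℕ, ∫ x, Real.exp (-(k * max x 0)) ∂(Q : Measure ℝ) =
      Real.exp (-∫ x, (1 - Real.exp (-(k * max x 0))) ∂ν) := by
  -- Away from 0, x ∧ 1 is bounded below, so these truncations are finite. Their compound Poisson
  -- laws converge to Q by Lévy's continuity theorem, and support and Laplace transform pass to the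
  -- limit.
  set m : ℕ → Measure ℝ := fun j => ν.restrict (Set.Ioi (1 / ((j : ℝ) + 1))) with hm
  have hfin : ∀ j, IsFiniteMeasure (m j) := fun j => by
    refine ⟨?_⟩
    rw [hm, Measure.restrict_apply_univ]
    have ha : (0 : ℝ) < 1 / ((j : ℝ) + 1) := by positivity
    refine (measure_mono fun x hx => ?_).trans_lt
      (hi.measure_norm_ge_lt_top (lt_min ha one_pos))
    have hx : 1 / ((j : ℝ) + 1) < x := hx
    rw [Set.mem_ofPred_eq, Real.norm_eq_abs, abs_of_pos (lt_min (ha.trans hx) one_pos)]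
    exact min_le_min_right _ hx.le
  have hm0 : ∀ j, ∀ᵐ x ∂m j, 0 ≤ x := fun j => by
    filter_upwards [ae_restrict_mem measurableSet_Ioi] with x hx
    exact le_trans (by positivity) (le_of_lt hx)
  set q : ℕ → ProbabilityMeasure ℝ := fun j => ⟨compoundPoisson (m j), inferInstance⟩ with hq
  have hlim : Tendsto q atTop (𝓝 Q) := by
    refine ProbabilityMeasure.tendsto_of_tendsto_charFun fun z => ?_
    have hc : ∀ j, charFun (q j : Measure ℝ) z =
        Complex.exp (∫ x, (Complex.exp (Complex.I * z * x) - 1) ∂m j) := fun j => by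
      rw [charFun_apply_real, ← integral_compoundPoisson (hm0 j) (by fun_prop) (fun x _ => ?_)
        (by simp) fun x y _ _ => by rw [← Complex.exp_add]; push_cast; ring_nf]
      · refine integral_congr_ae (Eventually.of_forall fun x => ?_)
        simp only
        ring_nf
      · rw [show Complex.I * (z : ℂ) * x = Complex.I * ((z * x : ℝ) : ℂ) by push_cast; ring,
          Complex.norm_exp_I_mul_ofReal]
    simp_rw [hc, hQ]
    exact (Complex.continuous_exp.tendsto _).comp
      (tendsto_setIntegral_Ioi_inv h0 (integrable_cexp_sub_one h0 hi z))
  constructor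
  -- Portmanteau on the open half-line (-∞,0), which none of the approximating laws charges.
  · have h1 := ProbabilityMeasure.le_liminf_measure_open_of_tendsto hlim (isOpen_Iio (a := (0 : ℝ)))
    have h2 : ∀ j, (q j : Measure ℝ) (Set.Iio 0) = 0 := fun j => by
      rw [measure_eq_zero_iff_ae_notMem]
      filter_upwards [ae_nonneg_compoundPoisson (hm0 j)] with x hx
      simpa using hx
    simp_rw [h2, liminf_const] at h1
    filter_upwards [measure_eq_zero_iff_ae_notMem.1 (le_antisymm h1 zero_le)] with x hx
    simpa using hx
  · intro k
    have hbd : ∀ x : ℝ, ‖Real.exp (-(k * max x 0))‖ ≤ 1 := fun x => by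
      rw [Real.norm_eq_abs, abs_of_pos (Real.exp_pos _), Real.exp_le_one_iff, neg_nonpos]
      positivity
    have h1 := (ProbabilityMeasure.tendsto_iff_forall_integral_tendsto.1 hlim)
      (BoundedContinuousFunction.ofNormedAddCommGroup _ (by fun_prop) 1 hbd)
    refine tendsto_nhds_unique h1 ?_
    have hc : ∀ j, ∫ x, Real.exp (-(k * max x 0)) ∂(q j : Measure ℝ) =
        Real.exp (-∫ x, (1 - Real.exp (-(k * max x 0))) ∂m j) := fun j => by
      have := integral_compoundPoisson (hm0 j) (h := fun x => ((Real.exp (-(k * max x 0)) : ℝ) : ℂ))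
        (by fun_prop) (fun x _ => by rw [Complex.norm_real]; exact hbd x) (by simp)
        fun x y hx hy => by
          rw [max_eq_left hx, max_eq_left hy, max_eq_left (add_nonneg hx hy), ← Complex.ofReal_mul,
            ← Real.exp_add]
          ring_nf
      simp_rw [← Complex.ofReal_one, ← Complex.ofReal_sub, integral_complex_ofReal,
        ← Complex.ofReal_exp] at this
      rw [← integral_neg]
      simp_rw [neg_sub]
      exact_mod_cast this
    simp only [BoundedContinuousFunction.coe_ofNormedAddCommGroup, hc]
    exact (Real.continuous_exp.tendsto _).comp
      (tendsto_setIntegral_Ioi_inv h0 (integrable_one_sub_exp h0 hi k)).neg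

/-- Weak convergence of laws of driftless subordinators amounts to convergence of their Laplace
exponents at the integers. -/
theorem tendsto_iff_laplaceExponent {Qs : ℕ → ProbabilityMeasure ℝ} {Q : ProbabilityMeasure ℝ}
    {νs : ℕ → Measure ℝ} {ν : Measure ℝ}
    (hνs : ∀ n, νs n (Set.Iic 0) = 0) (hν : ν (Set.Iic 0) = 0)
    (hi : ∀ n, Integrable (fun x => min x 1) (νs n)) (hi' : Integrable (fun x => min x 1) ν)
    (hQs : ∀ n, ∀ z : ℝ, charFun (Qs n : Measure ℝ) z =
      Complex.exp (∫ x : ℝ, (Complex.exp (Complex.I * z * x) - 1) ∂νs n))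
    (hQ : ∀ z : ℝ, charFun (Q : Measure ℝ) z =
      Complex.exp (∫ x : ℝ, (Complex.exp (Complex.I * z * x) - 1) ∂ν)) :
    Tendsto Qs atTop (𝓝 Q) ↔
      ∀ k : ℕ, IntegralTendsto νs ν (fun x => 1 - Real.exp (-(k * max x 0))) := by
  have hLs := fun n => laplace_of_charFun (hνs n) (hi n) (hQs n)
  have hL := laplace_of_charFun hν hi' hQ
  have hbd : ∀ (k : ℕ) (x : ℝ), ‖Real.exp (-(k * max x 0))‖ ≤ 1 := fun k x => by
    rw [Real.norm_eq_abs, abs_of_pos (Real.exp_pos _), Real.exp_le_one_iff, neg_nonpos]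
    positivity
  constructor
  · intro h k
    refine ⟨fun n => integrable_one_sub_exp (hνs n) (hi n) k, integrable_one_sub_exp hν hi' k, ?_⟩
    have h1 := (ProbabilityMeasure.tendsto_iff_forall_integral_tendsto.1 h)
      (BoundedContinuousFunction.ofNormedAddCommGroup _ (by fun_prop) 1 (hbd k))
    simp only [BoundedContinuousFunction.coe_ofNormedAddCommGroup, fun n => (hLs n).2 k,
      hL.2 k] at h1
    simpa using (h1.log (Real.exp_pos _).ne').neg
  · intro h
    rw [ProbabilityMeasure.tendsto_iff_forall_integral_tendsto]
    intro f
    refine (integralTendsto_of_laplace (fun n => (hLs n).1) hL.1 (fun k => ?_) f.continuous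
      f.norm_coe_le_norm).tendsto
    refine ⟨fun n => Integrable.of_bound (by fun_prop) 1 (Eventually.of_forall (hbd k)),
      Integrable.of_bound (by fun_prop) 1 (Eventually.of_forall (hbd k)), ?_⟩
    simp only [fun n => (hLs n).2 k, hL.2 k]
    exact (Real.continuous_exp.tendsto _).comp (h k).tendsto.neg

/-! ### Lévy triplets and the main theorem -/

/-- With `γ = ∫_{(0,1]} x ν(dx)` the compensator cancels from the Lévy-Khintchine exponent. -/
theorem levyExponent_eq {ν : Measure ℝ} (h0 : ν (Set.Iic 0) = 0)
    (hi : Integrable (fun x => min x 1) ν)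
    (hii : IntegrableOn (fun x : ℝ => x) (Set.Ioc 0 1) ν) (z : ℝ) :
    levyExponent (∫ x in Set.Ioc 0 1, x ∂ν) 0 ν z =
      ∫ x : ℝ, (Complex.exp (Complex.I * z * x) - 1) ∂ν := by
  have hae : Set.indicator {y : ℝ | |y| ≤ 1} (fun y : ℝ => Complex.I * z * y) =ᵐ[ν]
      fun x => Complex.I * z * ((Set.Ioc 0 1).indicator (fun x : ℝ => x) x : ℝ) := by
    filter_upwards [measure_eq_zero_iff_ae_notMem.1 h0] with x hx
    have hx : 0 < x := by simpa using hx
    by_cases h : x ≤ 1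
    · rw [Set.indicator_of_mem (by simpa [abs_of_pos hx] using h),
        Set.indicator_of_mem (Set.mem_Ioc.2 ⟨hx, h⟩)]
    · rw [Set.indicator_of_notMem (by simpa [abs_of_pos hx] using h),
        Set.indicator_of_notMem (by simp [h])]
      simp
  have hint : Integrable
      (fun x => Complex.I * z * ((Set.Ioc 0 1).indicator (fun x : ℝ => x) x : ℝ)) ν :=
    (((integrable_indicator_iff measurableSet_Ioc).2 hii).ofReal).const_mul _
  rw [levyExponent, integral_sub (integrable_cexp_sub_one h0 hi z) (hint.congr hae.symm),
    integral_congr_ae hae, integral_const_mul, integral_complex_ofReal,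
    integral_indicator measurableSet_Ioc]
  simp only [NNReal.coe_zero, Complex.ofReal_zero]
  ring

theorem charFun_incrementLaw {Ω : Type*} [MeasurableSpace Ω] {X : ℝ≥0 → Ω → ℝ} {P : Measure Ω}
    [IsProbabilityMeasure P] {γ : ℝ} {A : ℝ≥0} {ν : Measure ℝ} (hX : HasLevyTriplet X P γ A ν)
    (z : ℝ) : charFun (incrementLaw X P hX.isLevy : Measure ℝ) z =
      Complex.exp (levyExponent γ A ν z) := by
  rw [← hX.charFun_eq z]
  congr 1
  refine Measure.map_congr ?_
  filter_upwards [hX.isLevy.zero] with ω hω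
  simp [hω]

/-- Weak convergence of the increment laws of driftless pure-jump subordinators is equivalent to
weak convergence of the finite measures `γ_n δ₀ + (x² ∧ 1) ν_n` to `γ δ₀ + (x² ∧ 1) ν`. -/
theorem proposition1
    {Ωs : ℕ → Type*} [∀ n, MeasurableSpace (Ωs n)] (Ps : ∀ n, Measure (Ωs n))
    [∀ n, IsProbabilityMeasure (Ps n)] (Xs : ∀ n, ℝ≥0 → Ωs n → ℝ)
    (γs : ℕ → ℝ) (νs : ℕ → Measure ℝ)
    {Ω : Type*} [MeasurableSpace Ω] (P : Measure Ω)
    [IsProbabilityMeasure P] (X : ℝ≥0 → Ω → ℝ)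
    (γ : ℝ) (ν : Measure ℝ)
    -- the Lévy triplets are `(γ_n, 0, ν_n)` and `(γ, 0, ν)`
    (hXs : ∀ n, HasLevyTriplet (Xs n) (Ps n) (γs n) 0 (νs n))
    (hX : HasLevyTriplet X P γ 0 ν)
    -- the Lévy measures are on `(0, ∞)`
    (hνs_pos : ∀ n, νs n (Set.Iic 0) = 0)
    (hν_pos : ν (Set.Iic 0) = 0)
    -- `γ_n` and `γ` are the finite integrals of `x` over `(0, 1]`
    (hνs_int : ∀ n, IntegrableOn (fun x : ℝ => x) (Set.Ioc 0 1) (νs n))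
    (hν_int : IntegrableOn (fun x : ℝ => x) (Set.Ioc 0 1) ν)
    (hγs : ∀ n, γs n = ∫ x in Set.Ioc 0 1, x ∂(νs n))
    (hγ : γ = ∫ x in Set.Ioc 0 1, x ∂ν)
    -- the limiting Lévy measure has no atom at the truncation point (as holds when it has a density)
    (hν_one : ν {1} = 0) :
    Tendsto (fun n => incrementLaw (Xs n) (Ps n) (hXs n).isLevy) atTop
        (𝓝 (incrementLaw X P hX.isLevy)) ↔
      Tendsto (fun n => tildeFiniteMeasure (γs n) (νs n) (hXs n).isLevyMeasure) atTop
        (𝓝 (tildeFiniteMeasure γ ν hX.isLevyMeasure)) := by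

  have hi := fun n => integrable_min_one (hXs n).isLevyMeasure (hνs_pos n) (hνs_int n)
  have hi' := integrable_min_one hX.isLevyMeasure hν_pos hν_int
  rw [tendsto_iff_laplaceExponent hνs_pos hν_pos hi hi'
      (fun n z => by
        rw [charFun_incrementLaw (hXs n), hγs n, levyExponent_eq (hνs_pos n) (hi n) (hνs_int n)])
      (fun z => by rw [charFun_incrementLaw hX, hγ, levyExponent_eq hν_pos hi' hν_int]),
    laplaceExponent_tendsto_iff hνs_pos hν_pos,
    ← tendsto_integral_tildeMeasure_iff (fun n => (hXs n).isLevyMeasure) hX.isLevyMeasure hνs_pos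
      hν_pos hi hi' hγs hγ hν_one, FiniteMeasure.tendsto_iff_forall_integral_tendsto]
  constructor
  · exact fun h f => h f f.continuous ⟨‖f‖, f.norm_coe_le_norm⟩
  · rintro h f hf ⟨C, hC⟩
    exact h (BoundedContinuousFunction.ofNormedAddCommGroup f hf C hC)
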